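/- Let $R$ be a unital ring and let $(P,Q,\psi)$ be a unital $R$-system: $P$ and $Q$ are unital $R$-bimodules and $\psi\colon P\otimes_R Q\to R$ is an $R$-bimodule homomorphism, where $\otimes_R$ is the balanced tensor product. For $q\in Q$, $p\in P$ let $\theta_{q,p}\in\mathrm{End}(Q_R)$ and $\theta_{p,q}\in\mathrm{End}({}_RP)$ be given by $\theta_{q,p}(x)=q\cdot\psi(p\otimes x)$ and $\theta_{p,q}(y)=\psi(y\otimes q)\cdot p$, and let $\mathcal F_P(Q)$ and $\mathcal F_Q(P)$ be the $R$-linear spans of the $\theta_{q,p}$ and of the $\theta_{p,q}$, respectively. Let $\Delta\colon R\to\mathrm{End}(Q_R)$, $\Delta(r)(q)=rq$. Assume that $(P,Q,\psi)$ satisfies Condition (FS'): there are $\Theta\in\mathcal F_P(Q)$ and $\Phi\in\mathcal F_Q(P)$ with $\Theta(q)=q$ for all $q\in Q$ and $\Phi(p)=p$ for all $p\in P$. Let $J$ be a $\psi$-compatible ideal of $R$, i.e. a two-sided ideal with $\Delta(J)\subseteq\mathcal F_P(Q)$. A covariant representation $(S,T,\sigma,B)$ consists of a ring $B$ (not necessarily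 unital), additive maps $S\colon P\to B$, $T\colon Q\to B$ and a ring homomorphism $\sigma\colon R\to B$ with $S(pr)=S(p)\sigma(r)$, $S(rp)=\sigma(r)S(p)$, $T(qr)=T(q)\sigma(r)$, $T(rq)=\sigma(r)T(q)$ and $\sigma(\psi(p\otimes q))=S(p)T(q)$ for all $r\in R$, $p\in P$, $q\in Q$. Let $(\iota_P,\iota_Q,\iota_R,\mathcal T)$ be the universal covariant representation; $\mathcal T=\mathcal T_{(P,Q,\psi)}$ is the Toeplitz ring. It is $\mathbb Z$-graded by letting $\mathcal T_i$ be the sum, over all $m,n\ge 0$ with $m-n=i$, of the $R$-linear spans of the products $\iota_{Q^{\otimes m}}(q)\,\iota_{P^{\otimes n}}(p)$ with $q\in Q^{\otimes m}$, $p\in P^{\otimes n}$. Here $Q^{\otimes 0}=P^{\otimes 0}=R$, $\iota_{Q^{\otimes 0}}=\iota_{P^{\otimes 0}}=\iota_R$, and for $m,n\ge1$ the additive maps $\iota_{Q^{\otimes m}}$, $\iota_{P^{\otimes n}}$ are determined by $\iota_{Q^{\otimes m}}(q_1\otimes\cdots\otimes q_m)=\iota_Q(q_1)\cdots\iota_Q(q_m)$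 and $\iota_{P^{\otimes n}}(p_1\otimes\cdots\otimes p_n)=\iota_P(p_1)\cdots\iota_P(p_n)$. Let $\pi\colon\mathcal F_P(Q)\to\mathcal T$ be the additive map with $\pi(\theta_{q,p})=\iota_Q(q)\iota_P(p)$, and let $\mathcal T(J)$ be the two-sided ideal of $\mathcal T$ generated by $\{\iota_R(x)-\pi(\Delta(x)) : x\in J\}$. The relative Cuntz-Pimsner ring is $\mathcal O_{(P,Q,\psi)}(J)=\mathcal T/\mathcal T(J)$, and $\mathcal O_i$ denotes the image of $\mathcal T_i$ in it. Suppose that (a) $1_R\in J$, and (b) $\psi$ is surjective. Then $\mathcal O_{(P,Q,\psi)}(J)$ is strongly $\mathbb Z$-graded by $\{\mathcal O_i\}_{i\in\mathbb Z}$, that is, $\mathcal O_{(P,Q,\psi)}(J)=\bigoplus_{i\in\mathbb Z}\mathcal O_i$ and $\mathcal O_m\mathcal O_n=\mathcal O_{m+n}$ for all $m,n\in\mathbb Z$, where $\mathcal O_m\mathcal O_n$ is the set of finite sums of products. -/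

import Mathlib

open scoped TensorProduct

set_option linter.unusedSectionVars false

namespace CuntzPimsner

universe u v w x

/-! ### The balanced tensor product of bimodules over a noncommutative ring

Rings `R` are unital here. An `R`-bimodule is an abelian group with commuting (unital) actions of
`R` (from the left) and of `Rᵐᵒᵖ` (from the right, `MulOpposite.op r • p` being `p · r`). -/

section Balanced

variable (R : Type u) [Ring R]
  (P : Type v) [AddCommGroup P] [Module R P] [Module Rᵐᵒᵖ P] [SMulCommClass R Rᵐᵒᵖ P]
  (Q : Type w) [AddCommGroup Q] [Module R Q] [Module Rᵐᵒᵖ Q] [SMulCommClass R Rᵐᵒᵖ Q]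

/-- The relations `(p · r) ⊗ q = p ⊗ (r · q)`. -/
def balancedRel : AddSubgroup (P ⊗[ℤ] Q) :=
  AddSubgroup.closure
    {z | ∃ (p : P) (r : R) (q : Q), z = (MulOpposite.op r • p) ⊗ₜ[ℤ] q - p ⊗ₜ[ℤ] (r • q)}

/-- The balanced tensor product `P ⊗_R Q`. -/
def BalancedTensor : Type (max v w) := (P ⊗[ℤ] Q) ⧸ balancedRel R P Q

instance : AddCommGroup (BalancedTensor R P Q) :=
  inferInstanceAs (AddCommGroup ((P ⊗[ℤ] Q) ⧸ balancedRel R P Q))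

variable {P Q}

/-- The class of `p ⊗ q` in `P ⊗_R Q`. -/
def btmul (p : P) (q : Q) : BalancedTensor R P Q :=
  QuotientAddGroup.mk' (balancedRel R P Q) (p ⊗ₜ[ℤ] q)

variable {R}

theorem btmul_add (p : P) (q q' : Q) : btmul R p (q + q') = btmul R p q + btmul R p q' := by
  simp only [btmul, TensorProduct.tmul_add, map_add]; rfl

theorem add_btmul (p p' : P) (q : Q) : btmul R (p + p') q = btmul R p q + btmul R p' q := by
  simp only [btmul, TensorProduct.add_tmul, map_add]; rfl

theorem btmul_balanced (p : P) (r : R) (q : Q) :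
    btmul R (MulOpposite.op r • p) q = btmul R p (r • q) := by
  refine (QuotientAddGroup.eq_iff_sub_mem).2 (AddSubgroup.subset_closure ⟨p, r, q, rfl⟩)

theorem btensor_induction {C : BalancedTensor R P Q → Prop}
    (h0 : C 0) (hadd : ∀ a b, C a → C b → C (a + b)) (ht : ∀ p q, C (btmul R p q))
    (z : BalancedTensor R P Q) : C z := by
  obtain ⟨t, rfl⟩ := QuotientAddGroup.mk'_surjective (balancedRel R P Q) z
  induction t using TensorProduct.induction_on with
  | zero => exact h0
  | tmul p q => exact ht p q
  | add a b ha hb => exact hadd _ _ ha hb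

variable (P Q)

/-- Left multiplication by `r` on `P ⊗_R Q`, through the left action on `P`. -/
def lsmulHom (r : R) : BalancedTensor R P Q →+ BalancedTensor R P Q :=
  QuotientAddGroup.map (balancedRel R P Q) (balancedRel R P Q)
    (TensorProduct.map (DistribSMul.toAddMonoidHom P r).toIntLinearMap
      (LinearMap.id : Q →ₗ[ℤ] Q)).toAddMonoidHom
    ((AddSubgroup.closure_le _).2 (by
      rintro _ ⟨p, s, q, rfl⟩
      refine AddSubgroup.subset_closure ⟨r • p, s, q, ?_⟩
      simp [smul_comm r (MulOpposite.op s) p]))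

/-- Right multiplication by `r` on `P ⊗_R Q`, through the right action on `Q`. -/
def rsmulHom (r : Rᵐᵒᵖ) : BalancedTensor R P Q →+ BalancedTensor R P Q :=
  QuotientAddGroup.map (balancedRel R P Q) (balancedRel R P Q)
    (TensorProduct.map (LinearMap.id : P →ₗ[ℤ] P)
      (DistribSMul.toAddMonoidHom Q r).toIntLinearMap).toAddMonoidHom
    ((AddSubgroup.closure_le _).2 (by
      rintro _ ⟨p, s, q, rfl⟩
      refine AddSubgroup.subset_closure ⟨p, s, r • q, ?_⟩
      simp [smul_comm s r q]))

variable {P Q}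

theorem lsmulHom_btmul (r : R) (p : P) (q : Q) :
    lsmulHom P Q r (btmul R p q) = btmul R (r • p) q := rfl

theorem rsmulHom_btmul (r : Rᵐᵒᵖ) (p : P) (q : Q) :
    rsmulHom P Q r (btmul R p q) = btmul R p (r • q) := rfl

instance : Module R (BalancedTensor R P Q) where
  smul r z := lsmulHom P Q r z
  one_smul z := by
    change lsmulHom P Q 1 z = z
    induction z using btensor_induction with
    | h0 => simp
    | hadd a b ha hb => rw [map_add, ha, hb]
    | ht p q => rw [lsmulHom_btmul, one_smul]
  mul_smul r s z := by
    change lsmulHom P Q (r * s) z = lsmulHom P Q r (lsmulHom P Q s z)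
    induction z using btensor_induction with
    | h0 => simp
    | hadd a b ha hb => simp only [map_add, ha, hb]
    | ht p q => simp only [lsmulHom_btmul, mul_smul]
  smul_zero r := map_zero (lsmulHom P Q r)
  smul_add r := map_add (lsmulHom P Q r)
  add_smul r s z := by
    change lsmulHom P Q (r + s) z = lsmulHom P Q r z + lsmulHom P Q s z
    induction z using btensor_induction with
    | h0 => simp
    | hadd a b ha hb => simp only [map_add, ha, hb]; abel
    | ht p q => simp only [lsmulHom_btmul, add_smul, add_btmul]
  zero_smul z := by
    change lsmulHom P Q 0 z = 0
    induction z using btensor_induction with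
    | h0 => simp
    | hadd a b ha hb => rw [map_add, ha, hb, add_zero]
    | ht p q =>
      rw [lsmulHom_btmul, zero_smul]
      have h := add_btmul (R := R) (0 : P) 0 q
      simpa using h

instance : Module Rᵐᵒᵖ (BalancedTensor R P Q) where
  smul r z := rsmulHom P Q r z
  one_smul z := by
    change rsmulHom P Q 1 z = z
    induction z using btensor_induction with
    | h0 => simp
    | hadd a b ha hb => rw [map_add, ha, hb]
    | ht p q => rw [rsmulHom_btmul, one_smul]
  mul_smul r s z := by
    change rsmulHom P Q (r * s) z = rsmulHom P Q r (rsmulHom P Q s z)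
    induction z using btensor_induction with
    | h0 => simp
    | hadd a b ha hb => simp only [map_add, ha, hb]
    | ht p q => simp only [rsmulHom_btmul, mul_smul]
  smul_zero r := map_zero (rsmulHom P Q r)
  smul_add r := map_add (rsmulHom P Q r)
  add_smul r s z := by
    change rsmulHom P Q (r + s) z = rsmulHom P Q r z + rsmulHom P Q s z
    induction z using btensor_induction with
    | h0 => simp
    | hadd a b ha hb => simp only [map_add, ha, hb]; abel
    | ht p q => simp only [rsmulHom_btmul, add_smul, btmul_add]
  zero_smul z := by
    change rsmulHom P Q 0 z = 0
    induction z using btensor_induction with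
    | h0 => simp
    | hadd a b ha hb => rw [map_add, ha, hb, add_zero]
    | ht p q =>
      rw [rsmulHom_btmul, zero_smul]
      have h := btmul_add (R := R) p (0 : Q) 0
      simpa using h

theorem smul_btmul (r : R) (p : P) (q : Q) : r • btmul R p q = btmul R (r • p) q := rfl

theorem op_smul_btmul (r : Rᵐᵒᵖ) (p : P) (q : Q) : r • btmul R p q = btmul R p (r • q) := rfl

end Balanced

/-! ### `R`-systems, the operators `θ`, and Conditions (FS) and (FS') -/

/-- A unital `R`-system `(P, Q, ψ)` over a unital ring `R`: unital `R`-bimodules `P`, `Q` and an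
`R`-bimodule homomorphism `ψ : P ⊗_R Q → R`. -/
structure RSystem (R : Type u) [Ring R]
    (P : Type v) [AddCommGroup P] [Module R P] [Module Rᵐᵒᵖ P] [SMulCommClass R Rᵐᵒᵖ P]
    (Q : Type w) [AddCommGroup Q] [Module R Q] [Module Rᵐᵒᵖ Q] [SMulCommClass R Rᵐᵒᵖ Q] where
  psi : BalancedTensor R P Q →+ R
  psi_smul : ∀ (r : R) (z : BalancedTensor R P Q), psi (r • z) = r * psi z
  psi_op_smul : ∀ (r : R) (z : BalancedTensor R P Q), psi (MulOpposite.op r • z) = psi z * r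

section System

variable {R : Type u} [Ring R]
  {P : Type v} [AddCommGroup P] [Module R P] [Module Rᵐᵒᵖ P] [SMulCommClass R Rᵐᵒᵖ P]
  {Q : Type w} [AddCommGroup Q] [Module R Q] [Module Rᵐᵒᵖ Q] [SMulCommClass R Rᵐᵒᵖ Q]

/-- The two actions on a bimodule commute, in the other order: this makes `End(Q_R)` a left
`R`-module by `(r · f)(x) = r · f(x)`. -/
theorem bimodule_symm : SMulCommClass Rᵐᵒᵖ R Q := SMulCommClass.symm R Rᵐᵒᵖ Q

attribute [local instance] bimodule_symm

namespace RSystem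

variable (sys : RSystem R P Q)

theorem psi_left (r : R) (p : P) (q : Q) :
    sys.psi (btmul R (r • p) q) = r * sys.psi (btmul R p q) := sys.psi_smul r (btmul R p q)

theorem psi_right (r : R) (p : P) (q : Q) :
    sys.psi (btmul R p (MulOpposite.op r • q)) = sys.psi (btmul R p q) * r :=
  sys.psi_op_smul r (btmul R p q)

/-- `θ_{q,p}(x) = q · ψ(p ⊗ x)`, an endomorphism of the right `R`-module `Q`. -/
def thetaQ (q : Q) (p : P) : Module.End Rᵐᵒᵖ Q where
  toFun x := MulOpposite.op (sys.psi (btmul R p x)) • q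
  map_add' x y := by rw [btmul_add, map_add, MulOpposite.op_add, add_smul]
  map_smul' r x := by
    have h := sys.psi_right r.unop p x
    rw [MulOpposite.op_unop] at h
    rw [h, MulOpposite.op_mul, mul_smul]
    rfl

/-- `θ_{p,q}(y) = ψ(y ⊗ q) · p`, an endomorphism of the left `R`-module `P`. -/
def thetaP (p : P) (q : Q) : Module.End R P where
  toFun y := sys.psi (btmul R y q) • p
  map_add' x y := by rw [add_btmul, map_add, add_smul]
  map_smul' r x := by rw [sys.psi_left, mul_smul]; rfl

/-- `F_P(Q)`: the `R`-linear span of the `θ_{q,p}` in `End(Q_R)`. -/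
def finiteQ : Submodule R (Module.End Rᵐᵒᵖ Q) :=
  Submodule.span R {f | ∃ (q : Q) (p : P), f = sys.thetaQ q p}

/-- `F_Q(P)`: the `R`-linear span of the `θ_{p,q}` in `End(_R P)`, where `R` acts by
`(f · r)(y) = f(y) · r`. -/
def finiteP : Submodule Rᵐᵒᵖ (Module.End R P) :=
  Submodule.span Rᵐᵒᵖ {f | ∃ (p : P) (q : Q), f = sys.thetaP p q}

/-- Condition (FS). -/
def ConditionFS : Prop :=
  ∀ (A : Finset Q) (B : Finset P), ∃ Θ ∈ sys.finiteQ, ∃ Φ ∈ sys.finiteP,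
    (∀ q ∈ A, Θ q = q) ∧ (∀ p ∈ B, Φ p = p)

/-- Condition (FS'). -/
def ConditionFS' : Prop :=
  ∃ Θ ∈ sys.finiteQ, ∃ Φ ∈ sys.finiteP, (∀ q : Q, Θ q = q) ∧ (∀ p : P, Φ p = p)

theorem ConditionFS'.conditionFS {sys : RSystem R P Q} (h : sys.ConditionFS') :
    sys.ConditionFS := by
  obtain ⟨Θ, hΘ, Φ, hΦ, h1, h2⟩ := h
  exact fun _ _ => ⟨Θ, hΘ, Φ, hΦ, fun q _ => h1 q, fun p _ => h2 p⟩

/-- `Δ(r)(q) = r · q`. -/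
def Delta (_sys : RSystem R P Q) (r : R) : Module.End Rᵐᵒᵖ Q where
  toFun q := r • q
  map_add' := smul_add r
  map_smul' s q := smul_comm r s q

/-- A two-sided ideal `J` of `R` is `ψ`-compatible if `J ⊆ Δ⁻¹(F_P(Q))`. -/
def IsCompatible (J : TwoSidedIdeal R) : Prop := ∀ r ∈ J, sys.Delta r ∈ sys.finiteQ

end RSystem

/-! ### Covariant representations and the induced map `π` on `F_P(Q)` -/

/-- A covariant representation `(S, T, σ, B)` of `(P, Q, ψ)` in a ring `B`, which need not have
an identity element. -/
structure CovariantRep (sys : RSystem R P Q) (B : Type x) [NonUnitalRing B] where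
  S : P →+ B
  T : Q →+ B
  σ : R →ₙ+* B
  S_right : ∀ (p : P) (r : R), S (MulOpposite.op r • p) = S p * σ r
  S_left : ∀ (r : R) (p : P), S (r • p) = σ r * S p
  T_right : ∀ (q : Q) (r : R), T (MulOpposite.op r • q) = T q * σ r
  T_left : ∀ (r : R) (q : Q), T (r • q) = σ r * T q
  σ_psi : ∀ (p : P) (q : Q), σ (sys.psi (btmul R p q)) = S p * T q

section Pi

variable (sys : RSystem R P Q)

/-- The additive map `q ⊗ p ↦ θ_{q,p}` into `End(Q_R)`. -/
def thetaHom : Q ⊗[ℤ] P →+ Module.End Rᵐᵒᵖ Q :=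
  TensorProduct.liftAddHom
    { toFun := fun q =>
        { toFun := fun p => sys.thetaQ q p
          map_zero' := by
            refine LinearMap.ext fun x => ?_
            have h : btmul R (0 : P) x = 0 := by simpa using add_btmul (R := R) (0 : P) 0 x
            change MulOpposite.op (sys.psi (btmul R (0 : P) x)) • q = 0
            rw [h, map_zero, MulOpposite.op_zero, zero_smul]
          map_add' := fun p p' => by
            refine LinearMap.ext fun x => ?_
            change MulOpposite.op (sys.psi (btmul R (p + p') x)) • q =
              MulOpposite.op (sys.psi (btmul R p x)) • q +
              MulOpposite.op (sys.psi (btmul R p' x)) • q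
            rw [add_btmul, map_add, MulOpposite.op_add, add_smul] }
      map_zero' := by
        refine AddMonoidHom.ext fun p => LinearMap.ext fun x => ?_
        exact smul_zero (MulOpposite.op (sys.psi (btmul R p x)))
      map_add' := fun q q' => by
        refine AddMonoidHom.ext fun p => LinearMap.ext fun x => ?_
        exact smul_add (MulOpposite.op (sys.psi (btmul R p x))) q q' }
    (fun n q p => by
      refine LinearMap.ext fun x => ?_
      change MulOpposite.op (sys.psi (btmul R p x)) • (n • q) =
        MulOpposite.op (sys.psi (btmul R (n • p) x)) • q
      have h : btmul R (n • p) x = n • btmul R p x :=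
        map_zsmul (AddMonoidHom.mk' (fun p : P => btmul R p x)
          (fun a b => add_btmul a b x)) n p
      rw [h, map_zsmul, MulOpposite.op_smul, smul_assoc, smul_comm])

theorem thetaHom_tmul (q : Q) (p : P) : thetaHom sys (q ⊗ₜ[ℤ] p) = sys.thetaQ q p := rfl

theorem thetaHom_mem (t : Q ⊗[ℤ] P) : thetaHom sys t ∈ sys.finiteQ := by
  induction t using TensorProduct.induction_on with
  | zero => rw [map_zero]; exact zero_mem _
  | tmul q p => exact Submodule.subset_span ⟨q, p, rfl⟩
  | add a b ha hb => rw [map_add]; exact add_mem ha hb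

theorem exists_thetaHom {f : Module.End Rᵐᵒᵖ Q} (hf : f ∈ sys.finiteQ) :
    ∃ t, thetaHom sys t = f := by
  induction hf using Submodule.span_induction with
  | mem f h => obtain ⟨q, p, rfl⟩ := h; exact ⟨q ⊗ₜ p, rfl⟩
  | zero => exact ⟨0, map_zero _⟩
  | add f g _ _ hf hg =>
    obtain ⟨a, rfl⟩ := hf
    obtain ⟨b, rfl⟩ := hg
    exact ⟨a + b, map_add _ _ _⟩
  | smul r f hmem hf =>
    obtain ⟨a, rfl⟩ := hf
    clear hmem
    induction a using TensorProduct.induction_on with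
    | zero => exact ⟨0, by simp⟩
    | tmul q p =>
      refine ⟨(r • q) ⊗ₜ p, LinearMap.ext fun x => ?_⟩
      exact (smul_comm r (MulOpposite.op (sys.psi (btmul R p x))) q).symm
    | add a b ha hb =>
      obtain ⟨a', ha'⟩ := ha
      obtain ⟨b', hb'⟩ := hb
      exact ⟨a' + b', by rw [map_add, map_add, smul_add, ha', hb']⟩

/-- `q ⊗ p ↦ θ_{q,p}`, as a map onto `F_P(Q)`. -/
def thetaHom' : Q ⊗[ℤ] P →+ sys.finiteQ :=
  (thetaHom sys).codRestrict sys.finiteQ (thetaHom_mem sys)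

theorem thetaHom'_surjective : Function.Surjective (thetaHom' sys) := by
  rintro ⟨f, hf⟩
  obtain ⟨t, ht⟩ := exists_thetaHom sys hf
  exact ⟨t, Subtype.ext ht⟩

namespace CovariantRep

variable {sys} {B : Type x} [NonUnitalRing B] (ρ : CovariantRep sys B)

/-- The additive map `q ⊗ p ↦ T(q) S(p)`. -/
def tsHom : Q ⊗[ℤ] P →+ B :=
  TensorProduct.liftAddHom ((AddMonoidHom.mul.compl₂ ρ.S).comp ρ.T)
    (fun n q p => by
      change ρ.T (n • q) * ρ.S p = ρ.T q * ρ.S (n • p)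
      rw [map_zsmul, map_zsmul, smul_mul_assoc, mul_smul_comm])

theorem tsHom_tmul (q : Q) (p : P) : ρ.tsHom (q ⊗ₜ[ℤ] p) = ρ.T q * ρ.S p := rfl

theorem tsHom_mul_T (t : Q ⊗[ℤ] P) (q : Q) : ρ.tsHom t * ρ.T q = ρ.T (thetaHom sys t q) := by
  induction t using TensorProduct.induction_on with
  | zero => simp
  | tmul q' p =>
    rw [tsHom_tmul, mul_assoc, ← ρ.σ_psi, ← ρ.T_right]; rfl
  | add a b ha hb => rw [map_add, add_mul, ha, hb, map_add, LinearMap.add_apply, map_add]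

/-- Under Condition (FS), a relation `∑ θ_{q_i,p_i} = 0` implies `∑ T(q_i) S(p_i) = 0`. -/
theorem tsHom_eq_zero (h : sys.ConditionFS) (t : Q ⊗[ℤ] P) (ht : thetaHom sys t = 0) :
    ρ.tsHom t = 0 := by
  classical
  -- every operator in `F_Q(P)` composes with `S` as `S(Φ(p)) = S(p) b` for some `b ∈ T(Q) S(P)`
  have key : ∀ Φ ∈ sys.finiteP, ∃ s : Q ⊗[ℤ] P, ∀ p, ρ.S (Φ p) = ρ.S p * ρ.tsHom s := by
    intro Φ hΦ
    induction hΦ using Submodule.span_induction with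
    | mem f h =>
      obtain ⟨p, q, rfl⟩ := h
      refine ⟨q ⊗ₜ p, fun y => ?_⟩
      rw [tsHom_tmul, ← mul_assoc, ← ρ.σ_psi, ← ρ.S_left]; rfl
    | zero => exact ⟨0, fun p => by simp⟩
    | add f g _ _ hf hg =>
      obtain ⟨a, ha⟩ := hf
      obtain ⟨b, hb⟩ := hg
      exact ⟨a + b, fun p => by
        rw [LinearMap.add_apply, map_add, ha, hb, map_add, mul_add]⟩
    | smul r f _ hf =>
      obtain ⟨a, ha⟩ := hf
      have hr : ∃ a', ρ.tsHom a' = ρ.tsHom a * ρ.σ r.unop := by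
        clear ha
        induction a using TensorProduct.induction_on with
        | zero => exact ⟨0, by simp⟩
        | tmul q p =>
          refine ⟨q ⊗ₜ (MulOpposite.op r.unop • p), ?_⟩
          rw [tsHom_tmul, tsHom_tmul, ρ.S_right, mul_assoc]
        | add a b ha hb =>
          obtain ⟨a', ha'⟩ := ha
          obtain ⟨b', hb'⟩ := hb
          exact ⟨a' + b', by rw [map_add, map_add, add_mul, ha', hb']⟩
      obtain ⟨a', ha'⟩ := hr
      refine ⟨a', fun p => ?_⟩
      have := ρ.S_right (f p) r.unop
      rw [MulOpposite.op_unop] at this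
      rw [LinearMap.smul_apply, this, ha, ha', mul_assoc]
  -- the second tensor legs of `t` lie in a finite set
  have supp : ∀ t : Q ⊗[ℤ] P, ∃ A : Finset P, ∀ s : Q ⊗[ℤ] P,
      (∀ p ∈ A, ρ.S p = ρ.S p * ρ.tsHom s) → ρ.tsHom t = ρ.tsHom t * ρ.tsHom s := by
    intro t
    induction t using TensorProduct.induction_on with
    | zero => exact ⟨∅, fun s _ => by simp⟩
    | tmul q p =>
      refine ⟨{p}, fun s hs => ?_⟩
      rw [tsHom_tmul, mul_assoc, ← hs p (Finset.mem_singleton_self p)]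
    | add a b ha hb =>
      obtain ⟨A, hA⟩ := ha
      obtain ⟨A', hA'⟩ := hb
      refine ⟨A ∪ A', fun s hs => ?_⟩
      rw [map_add, add_mul, ← hA s fun p hp => hs p (Finset.mem_union_left _ hp),
        ← hA' s fun p hp => hs p (Finset.mem_union_right _ hp)]
  obtain ⟨A, hA⟩ := supp t
  obtain ⟨_, _, Φ, hΦ, _, hfix⟩ := h ∅ A
  obtain ⟨s, hs⟩ := key Φ hΦ
  rw [hA s fun p hp => by rw [← hs, hfix p hp]]
  clear hs
  induction s using TensorProduct.induction_on with
  | zero => simp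
  | tmul q p =>
    rw [tsHom_tmul ρ q p, ← mul_assoc, tsHom_mul_T, ht, LinearMap.zero_apply, map_zero, zero_mul]
  | add a b ha hb => rw [map_add, mul_add, ha, hb, add_zero]

/-- The map `π_{T,S} : F_P(Q) → B` with `π_{T,S}(θ_{q,p}) = T(q) S(p)`; it is well defined under
Condition (FS). -/
noncomputable def pi (h : sys.ConditionFS) : sys.finiteQ →+ B :=
  (thetaHom' sys).liftOfSurjective (thetaHom'_surjective sys)
    ⟨ρ.tsHom, fun t ht => ρ.tsHom_eq_zero h t
      (congrArg Subtype.val ((AddMonoidHom.mem_ker).1 ht))⟩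

theorem pi_theta (h : sys.ConditionFS) (q : Q) (p : P) (hm : sys.thetaQ q p ∈ sys.finiteQ) :
    ρ.pi h ⟨sys.thetaQ q p, hm⟩ = ρ.T q * ρ.S p :=
  AddMonoidHom.liftOfRightInverse_comp_apply (thetaHom' sys) _ _
    ⟨ρ.tsHom, _⟩ (q ⊗ₜ[ℤ] p)

end CovariantRep

end Pi

/-! ### The Toeplitz ring -/

/-- The defining relations of the Toeplitz ring, on generators `ι(r)`, `ι(p)`, `ι(q)` for
`r ∈ R`, `p ∈ P`, `q ∈ Q`. -/
inductive ToeplitzRel (sys : RSystem R P Q) :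
    FreeAlgebra ℤ (R ⊕ P ⊕ Q) → FreeAlgebra ℤ (R ⊕ P ⊕ Q) → Prop
  | one : ToeplitzRel sys (FreeAlgebra.ι ℤ (.inl 1)) 1
  | R_add (r s : R) : ToeplitzRel sys (FreeAlgebra.ι ℤ (.inl (r + s)))
      (FreeAlgebra.ι ℤ (.inl r) + FreeAlgebra.ι ℤ (.inl s))
  | R_mul (r s : R) : ToeplitzRel sys (FreeAlgebra.ι ℤ (.inl (r * s)))
      (FreeAlgebra.ι ℤ (.inl r) * FreeAlgebra.ι ℤ (.inl s))
  | P_add (p p' : P) : ToeplitzRel sys (FreeAlgebra.ι ℤ (.inr (.inl (p + p'))))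
      (FreeAlgebra.ι ℤ (.inr (.inl p)) + FreeAlgebra.ι ℤ (.inr (.inl p')))
  | Q_add (q q' : Q) : ToeplitzRel sys (FreeAlgebra.ι ℤ (.inr (.inr (q + q'))))
      (FreeAlgebra.ι ℤ (.inr (.inr q)) + FreeAlgebra.ι ℤ (.inr (.inr q')))
  | P_right (p : P) (r : R) : ToeplitzRel sys
      (FreeAlgebra.ι ℤ (.inr (.inl (MulOpposite.op r • p))))
      (FreeAlgebra.ι ℤ (.inr (.inl p)) * FreeAlgebra.ι ℤ (.inl r))
  | P_left (r : R) (p : P) : ToeplitzRel sys (FreeAlgebra.ι ℤ (.inr (.inl (r • p))))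
      (FreeAlgebra.ι ℤ (.inl r) * FreeAlgebra.ι ℤ (.inr (.inl p)))
  | Q_right (q : Q) (r : R) : ToeplitzRel sys
      (FreeAlgebra.ι ℤ (.inr (.inr (MulOpposite.op r • q))))
      (FreeAlgebra.ι ℤ (.inr (.inr q)) * FreeAlgebra.ι ℤ (.inl r))
  | Q_left (r : R) (q : Q) : ToeplitzRel sys (FreeAlgebra.ι ℤ (.inr (.inr (r • q))))
      (FreeAlgebra.ι ℤ (.inl r) * FreeAlgebra.ι ℤ (.inr (.inr q)))
  | R_psi (p : P) (q : Q) : ToeplitzRel sys (FreeAlgebra.ι ℤ (.inl (sys.psi (btmul R p q))))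
      (FreeAlgebra.ι ℤ (.inr (.inl p)) * FreeAlgebra.ι ℤ (.inr (.inr q)))

/-- The Toeplitz ring `T_{(P,Q,ψ)}`, by generators and relations. That it carries the universal
covariant representation, among those in arbitrary (not necessarily unital) rings, is
`toeplitz_universal` below. -/
def Toeplitz (sys : RSystem R P Q) : Type (max u v w) := RingQuot (ToeplitzRel sys)

instance (sys : RSystem R P Q) : Ring (Toeplitz sys) :=
  inferInstanceAs (Ring (RingQuot (ToeplitzRel sys)))

/-- The canonical map from the free ring on the generators. -/
def toeplitzMk (sys : RSystem R P Q) : FreeAlgebra ℤ (R ⊕ P ⊕ Q) →+* Toeplitz sys :=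
  RingQuot.mkRingHom (ToeplitzRel sys)

theorem toeplitzMk_rel (sys : RSystem R P Q) {a b : FreeAlgebra ℤ (R ⊕ P ⊕ Q)}
    (h : ToeplitzRel sys a b) : toeplitzMk sys a = toeplitzMk sys b :=
  RingQuot.mkRingHom_rel h

/-- The Toeplitz representation `(ι_P, ι_Q, ι_R, T_{(P,Q,ψ)})`. -/
def toeplitzRep (sys : RSystem R P Q) : CovariantRep sys (Toeplitz sys) where
  S := AddMonoidHom.mk' (fun p => toeplitzMk sys (FreeAlgebra.ι ℤ (.inr (.inl p))))
    (fun a b => by rw [toeplitzMk_rel sys (.P_add a b), map_add])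
  T := AddMonoidHom.mk' (fun q => toeplitzMk sys (FreeAlgebra.ι ℤ (.inr (.inr q))))
    (fun a b => by rw [toeplitzMk_rel sys (.Q_add a b), map_add])
  σ :=
    { AddMonoidHom.mk' (fun r => toeplitzMk sys (FreeAlgebra.ι ℤ (.inl r)))
        (fun a b => by rw [toeplitzMk_rel sys (.R_add a b), map_add]) with
      map_mul' := fun a b => (toeplitzMk_rel sys (.R_mul a b)).trans (map_mul _ _ _) }
  S_right p r := (toeplitzMk_rel sys (.P_right p r)).trans (map_mul _ _ _)
  S_left r p := (toeplitzMk_rel sys (.P_left r p)).trans (map_mul _ _ _)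
  T_right q r := (toeplitzMk_rel sys (.Q_right q r)).trans (map_mul _ _ _)
  T_left r q := (toeplitzMk_rel sys (.Q_left r q)).trans (map_mul _ _ _)
  σ_psi p q := (toeplitzMk_rel sys (.R_psi p q)).trans (map_mul _ _ _)

theorem toeplitzRep_one (sys : RSystem R P Q) : (toeplitzRep sys).σ 1 = 1 :=
  (toeplitzMk_rel sys .one).trans (map_one _)

theorem toeplitz_hom_ext (sys : RSystem R P Q) {B : Type x} [NonUnitalRing B]
    (f g : Toeplitz sys →ₙ+* B)
    (hσ : ∀ r, f ((toeplitzRep sys).σ r) = g ((toeplitzRep sys).σ r))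
    (hS : ∀ p, f ((toeplitzRep sys).S p) = g ((toeplitzRep sys).S p))
    (hT : ∀ q, f ((toeplitzRep sys).T q) = g ((toeplitzRep sys).T q)) : f = g := by
  refine NonUnitalRingHom.ext fun z => ?_
  obtain ⟨a, rfl⟩ := RingQuot.mkRingHom_surjective (ToeplitzRel sys) z
  change f (toeplitzMk sys a) = g (toeplitzMk sys a)
  induction a using FreeAlgebra.induction with
  | grade0 n =>
    have h1 : toeplitzMk sys (algebraMap ℤ _ n) = n • (toeplitzRep sys).σ 1 := by
      rw [toeplitzRep_one]; simp
    rw [h1, map_zsmul, map_zsmul, hσ]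
  | grade1 y =>
    rcases y with r | p | q
    · exact hσ r
    · exact hS p
    · exact hT q
  | mul a b ha hb => rw [map_mul, map_mul, map_mul, ha, hb]
  | add a b ha hb => rw [map_add, map_add, map_add, ha, hb]

/-- The universal property of the Toeplitz representation. -/
theorem toeplitz_universal (sys : RSystem R P Q) {B : Type x} [NonUnitalRing B]
    (ρ : CovariantRep sys B) :
    ∃! η : Toeplitz sys →ₙ+* B,
      (∀ r, η ((toeplitzRep sys).σ r) = ρ.σ r) ∧ (∀ p, η ((toeplitzRep sys).S p) = ρ.S p) ∧
      (∀ q, η ((toeplitzRep sys).T q) = ρ.T q) := by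
  have he : IsIdempotentElem (ρ.σ 1) := by
    change ρ.σ 1 * ρ.σ 1 = ρ.σ 1
    rw [← map_mul, mul_one]
  have mem : ∀ b : B, ρ.σ 1 * b = b → b * ρ.σ 1 = b → b ∈ Subsemigroup.corner (ρ.σ 1) :=
    fun b h1 h2 => (Subsemigroup.mem_corner_iff he).2 ⟨h1, h2⟩
  let gen : R ⊕ P ⊕ Q → he.Corner := fun y => match y with
    | .inl r => ⟨ρ.σ r, mem _ (by rw [← map_mul, one_mul]) (by rw [← map_mul, mul_one])⟩
    | .inr (.inl p) => ⟨ρ.S p, mem _ (by rw [← ρ.S_left, one_smul])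
        (by rw [← ρ.S_right, MulOpposite.op_one, one_smul])⟩
    | .inr (.inr q) => ⟨ρ.T q, mem _ (by rw [← ρ.T_left, one_smul])
        (by rw [← ρ.T_right, MulOpposite.op_one, one_smul])⟩
  let F : FreeAlgebra ℤ (R ⊕ P ⊕ Q) →+* he.Corner := (FreeAlgebra.lift ℤ gen).toRingHom
  have hF : ∀ y, F (FreeAlgebra.ι ℤ y) = gen y := fun y => FreeAlgebra.lift_ι_apply gen y
  have hrel : ∀ ⦃a b⦄, ToeplitzRel sys a b → F a = F b := by
    intro a b hab
    induction hab with
    | one => exact (hF _).trans (map_one F).symm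
    | R_add r s => rw [map_add, hF, hF, hF]; exact Subtype.ext (map_add ρ.σ r s)
    | R_mul r s => rw [map_mul, hF, hF, hF]; exact Subtype.ext (map_mul ρ.σ r s)
    | P_add r s => rw [map_add, hF, hF, hF]; exact Subtype.ext (map_add ρ.S r s)
    | Q_add r s => rw [map_add, hF, hF, hF]; exact Subtype.ext (map_add ρ.T r s)
    | P_right p r => rw [map_mul, hF, hF, hF]; exact Subtype.ext (ρ.S_right p r)
    | P_left r p => rw [map_mul, hF, hF, hF]; exact Subtype.ext (ρ.S_left r p)
    | Q_right q r => rw [map_mul, hF, hF, hF]; exact Subtype.ext (ρ.T_right q r)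
    | Q_left r q => rw [map_mul, hF, hF, hF]; exact Subtype.ext (ρ.T_left r q)
    | R_psi p q => rw [map_mul, hF, hF, hF]; exact Subtype.ext (ρ.σ_psi p q)
  let G : Toeplitz sys →+* he.Corner := RingQuot.lift ⟨F, hrel⟩
  have hG : ∀ y, G (toeplitzMk sys (FreeAlgebra.ι ℤ y)) = gen y := fun y => by
    rw [← hF y]; exact RingQuot.lift_mkRingHom_apply F hrel _
  let incl : he.Corner →ₙ+* B :=
    { toFun := Subtype.val
      map_mul' := fun _ _ => rfl
      map_zero' := rfl
      map_add' := fun _ _ => rfl }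
  let η : Toeplitz sys →ₙ+* B := incl.comp (G : Toeplitz sys →ₙ+* he.Corner)
  have hη : ∀ y, η (toeplitzMk sys (FreeAlgebra.ι ℤ y)) = (gen y).1 :=
    fun y => congrArg Subtype.val (hG y)
  refine ⟨η, ⟨fun r => hη (.inl r), fun p => hη (.inr (.inl p)),
    fun q => hη (.inr (.inr q))⟩, ?_⟩
  rintro η' ⟨h1, h2, h3⟩
  exact toeplitz_hom_ext sys η' η (fun r => (h1 r).trans (hη (.inl r)).symm)
    (fun p => (h2 p).trans (hη (.inr (.inl p))).symm)
    (fun q => (h3 q).trans (hη (.inr (.inr q))).symm)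

/-! ### The canonical `ℤ`-gradings, and relative Cuntz-Pimsner rings -/

/-- The image of `ι_{Q^{⊗ m}} : Q^{⊗ m} → T_{(P,Q,ψ)}`, i.e. the additive span of the products
`ι_Q(q₁) ⋯ ι_Q(q_m)`, and `ι_R(R)` for `m = 0` since `Q^{⊗ 0} = R`. (In the product of two additive
subgroups all finite sums of products are taken.) -/
def toeplitzQ (sys : RSystem R P Q) : ℕ → Submodule ℤ (Toeplitz sys)
  | 0 => LinearMap.range ((toeplitzRep sys).σ : R →+ Toeplitz sys).toIntLinearMap
  | m + 1 => toeplitzQ sys m * LinearMap.range (toeplitzRep sys).T.toIntLinearMap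

/-- The image of `ι_{P^{⊗ n}} : P^{⊗ n} → T_{(P,Q,ψ)}`. -/
def toeplitzP (sys : RSystem R P Q) : ℕ → Submodule ℤ (Toeplitz sys)
  | 0 => LinearMap.range ((toeplitzRep sys).σ : R →+ Toeplitz sys).toIntLinearMap
  | n + 1 => LinearMap.range (toeplitzRep sys).S.toIntLinearMap * toeplitzP sys n

/-- `T_{(m,n)}`, the span of the `ι_{Q^{⊗ m}}(q) ι_{P^{⊗ n}}(p)`. The additive span is already
`R`-linear because `ι_R(r) ι_{Q^{⊗ m}}(q) = ι_{Q^{⊗ m}}(r q)`. -/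
def toeplitzBi (sys : RSystem R P Q) (m n : ℕ) : Submodule ℤ (Toeplitz sys) :=
  toeplitzQ sys m * toeplitzP sys n

/-- The canonical grading of the Toeplitz ring: `T_i` is the sum of the `T_{(m,n)}` with
`m - n = i`. -/
def toeplitzGrading (sys : RSystem R P Q) (i : ℤ) : Submodule ℤ (Toeplitz sys) :=
  ⨆ (m : ℕ) (n : ℕ) (_ : (m : ℤ) - (n : ℤ) = i), toeplitzBi sys m n

/-- The ideal `T(J)` of the Toeplitz ring generated by the `ι_R(r) - π(Δ(r))` with `r ∈ J`. -/
noncomputable def cpIdeal (sys : RSystem R P Q) (h : sys.ConditionFS) (J : TwoSidedIdeal R)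
    (hJ : sys.IsCompatible J) : TwoSidedIdeal (Toeplitz sys) :=
  TwoSidedIdeal.span {z | ∃ (r : R) (hr : r ∈ J),
    z = (toeplitzRep sys).σ r - (toeplitzRep sys).pi h ⟨sys.Delta r, hJ r hr⟩}

/-- The Cuntz-Pimsner ring `O_{(P,Q,ψ)}(J) = T_{(P,Q,ψ)} / T(J)` relative to `J`. -/
abbrev CPRing (sys : RSystem R P Q) (h : sys.ConditionFS) (J : TwoSidedIdeal R)
    (hJ : sys.IsCompatible J) : Type (max u v w) :=
  (cpIdeal sys h J hJ).ringCon.Quotient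

/-- The canonical grading of the relative Cuntz-Pimsner ring: the images of the `T_i` under the
quotient map. -/
noncomputable def cpGrading (sys : RSystem R P Q) (h : sys.ConditionFS) (J : TwoSidedIdeal R)
    (hJ : sys.IsCompatible J) (i : ℤ) : Submodule ℤ (CPRing sys h J hJ) :=
  (toeplitzGrading sys i).map
    ((cpIdeal sys h J hJ).ringCon.mk' : Toeplitz sys →+ CPRing sys h J hJ).toIntLinearMap

end System

/-- The additive subgroups `A i` form a strong `ℤ`-grading of `B`: `B` is their internal direct
sum, and `A m * A n`, the set of finite sums of products, equals `A (m + n)`. -/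
def IsStrongZGrading {B : Type u} [Ring B] (A : ℤ → Submodule ℤ B) : Prop :=
  DirectSum.IsInternal A ∧ ∀ m n : ℤ, A m * A n = A (m + n)

end CuntzPimsner

/-!
The relative Cuntz-Pimsner ring `O` carries a coaction of `ℤ`: the universal property of the
Toeplitz ring, applied to the representation `p ↦ S(p) X⁻¹`, `q ↦ T(q) X`, `r ↦ σ(r)` in `O[X, X⁻¹]`,
gives a ring homomorphism that kills `T(J)`, because the generators of `T(J)` are homogeneous of
degree `0`; it therefore descends to `δ : O → O[X, X⁻¹]` with `δ(x) = x Xⁱ` for `x ∈ O_i`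
(`exists_cpCoaction`). Reading off coefficients shows that the `O_i` are independent and that
`O_m O_n ⊆ O_{m+n}`, as soon as the `O_i` span `O` (`isInternal_of_coaction`, `mul_le_of_coaction`).
They do, because the sum of the `T_i` contains `1` and is stable under left multiplication by the
generators of the Toeplitz ring (`iSup_toeplitzGrading`): `ι_P(p) ι_Q(q) = ι_R(ψ(p ⊗ q))` always
brings a product into the form `ι_{Q^{⊗ m}}(x) ι_{P^{⊗ n}}(y)`.

A `ℤ`-grading is strong once `1 ∈ A₁ A₋₁` and `1 ∈ A₋₁ A₁` (`isStrongZGrading_of_one_mem`). The first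
holds since `1 ∈ J` makes `1 = π(Δ(1))` in `O`, a sum of products `ι_Q(q) ι_P(p)`; the second since
`1 = ψ(∑ pᵢ ⊗ qᵢ) = ∑ ι_P(pᵢ) ι_Q(qᵢ)` by surjectivity of `ψ`.
-/

namespace CuntzPimsner

universe u' v' w' x'

/-! ### Gradings detected by a coaction -/

section Coaction

variable {B : Type x'} [Ring B] {A : ℤ → Submodule ℤ B}

/-- A family of additive subgroups spanning `B` is an internal direct sum if some additive map
`B → B[ℤ]` sends each `x ∈ A i` to `x Xⁱ`: its `i`-th coefficient is a projection onto `A i`. -/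
theorem isInternal_of_coaction (δ : B →+ AddMonoidAlgebra B ℤ)
    (hδ : ∀ i, ∀ x ∈ A i, δ x = AddMonoidAlgebra.single i x) (htop : ⨆ i, A i = ⊤) :
    DirectSum.IsInternal A := by
  classical
  have key : ∀ (f : DirectSum ℤ fun i => A i) (i : ℤ),
      (δ (DirectSum.coeAddMonoidHom A f)).coeff i = (f i : B) := by
    intro f i
    induction f using DirectSum.induction_on with
    | zero => simp
    | of j x =>
      rw [DirectSum.coeAddMonoidHom_of, hδ j x x.2, DirectSum.coe_of_apply,
        AddMonoidAlgebra.coeff_single, Finsupp.single_apply]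
      split_ifs <;> rfl
    | add f g hf hg => simp [hf, hg]
  constructor
  · refine (injective_iff_map_eq_zero _).2 fun f hf => DFinsupp.ext fun i => Subtype.ext ?_
    change (f i : B) = 0
    rw [← key, hf]
    simp
  · intro b
    have hb : b ∈ ⨆ i, A i := htop ▸ Submodule.mem_top
    induction hb using Submodule.iSup_induction' with
    | mem i x hx => exact ⟨DirectSum.of (fun i => A i) i ⟨x, hx⟩, DirectSum.coeAddMonoidHom_of _ _ _⟩
    | zero => exact ⟨0, map_zero _⟩
    | add x y _ _ hx hy =>
      obtain ⟨f, rfl⟩ := hx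
      obtain ⟨g, rfl⟩ := hy
      exact ⟨f + g, map_add _ _ _⟩

/-- If the `A i` span `B` and `δ` multiplies each `x ∈ A i` by `Xⁱ`, then `A i` contains every
element that `δ` multiplies by `Xⁱ`. -/
theorem mem_of_coaction (δ : B →+ AddMonoidAlgebra B ℤ)
    (hδ : ∀ i, ∀ x ∈ A i, δ x = AddMonoidAlgebra.single i x) (htop : ⨆ i, A i = ⊤)
    {i : ℤ} {x : B} (hx : δ x = AddMonoidAlgebra.single i x) : x ∈ A i := by
  have coeff_mem : ∀ y : B, (δ y).coeff i ∈ A i := by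
    intro y
    have hy : y ∈ ⨆ i, A i := htop ▸ Submodule.mem_top
    induction hy using Submodule.iSup_induction' with
    | mem j y hy =>
      rw [hδ j y hy, AddMonoidAlgebra.coeff_single, Finsupp.single_apply]
      split_ifs with h
      · exact h ▸ hy
      · exact zero_mem _
    | zero => simp
    | add y z _ _ hy hz =>
      rw [map_add, AddMonoidAlgebra.coeff_add, Finsupp.add_apply]
      exact add_mem hy hz
  have := coeff_mem x
  rwa [hx, AddMonoidAlgebra.coeff_single, Finsupp.single_eq_same] at this

theorem mul_le_of_coaction (δ : B →+* AddMonoidAlgebra B ℤ)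
    (hδ : ∀ i, ∀ x ∈ A i, δ x = AddMonoidAlgebra.single i x) (htop : ⨆ i, A i = ⊤) (i j : ℤ) :
    A i * A j ≤ A (i + j) := by
  refine Submodule.mul_le.2 fun x hx y hy => mem_of_coaction δ.toAddMonoidHom hδ htop ?_
  change δ (x * y) = _
  rw [map_mul, hδ i x hx, hδ j y hy, AddMonoidAlgebra.single_mul_single]

/-- A `ℤ`-grading with `1 ∈ A₁ A₋₁` and `1 ∈ A₋₁ A₁` is strong. -/
theorem isStrongZGrading_of_one_mem (hint : DirectSum.IsInternal A)
    (hmul : ∀ i j, A i * A j ≤ A (i + j)) (hpos : (1 : B) ∈ A 1 * A (-1))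
    (hneg : (1 : B) ∈ A (-1) * A 1) : IsStrongZGrading A := by
  have one_mem_pow : ∀ X Y : Submodule ℤ B, (1 : B) ∈ X * Y → ∀ k : ℕ, (1 : B) ∈ X ^ k * Y ^ k := by
    intro X Y h k
    induction k with
    | zero => rw [pow_zero, pow_zero, one_mul]; exact Submodule.one_le.1 le_rfl
    | succ k ih =>
      rw [← Submodule.one_le] at h ih ⊢
      calc (1 : Submodule ℤ B) ≤ X ^ k * Y ^ k := ih
        _ = X ^ k * 1 * Y ^ k := by rw [mul_one]
        _ ≤ X ^ k * (X * Y) * Y ^ k := by gcongr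
        _ = X ^ (k + 1) * Y ^ (k + 1) := by rw [pow_succ X, pow_succ' Y]; simp only [mul_assoc]
  have one_mem_zero : (1 : B) ∈ A 0 := by simpa using hmul 1 (-1) hpos
  have pow_le : ∀ (i : ℤ) (k : ℕ), A i ^ k ≤ A (k * i) := by
    intro i k
    induction k with
    | zero => simpa using one_mem_zero
    | succ k ih =>
      calc A i ^ (k + 1) = A i ^ k * A i := pow_succ _ _
        _ ≤ A (k * i) * A i := by gcongr
        _ ≤ A (k * i + i) := hmul _ _
        _ = A ((k + 1 : ℕ) * i) := by push_cast; ring_nf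
  -- `1 ∈ A₋₁ᵏ A₁ᵏ ⊆ A₋ₖ Aₖ`, and the same with the signs exchanged
  have one_le : ∀ n : ℤ, (1 : Submodule ℤ B) ≤ A (-n) * A n := by
    intro n
    obtain ⟨k, rfl | rfl⟩ := n.eq_nat_or_neg
    · refine (Submodule.one_le.2 (one_mem_pow _ _ hneg k)).trans ?_
      simpa using mul_le_mul' (pow_le (-1) k) (pow_le 1 k)
    · refine (Submodule.one_le.2 (one_mem_pow _ _ hpos k)).trans ?_
      simpa using mul_le_mul' (pow_le 1 k) (pow_le (-1) k)
  refine ⟨hint, fun m n => le_antisymm (hmul m n) ?_⟩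
  calc A (m + n) = A (m + n) * 1 := (mul_one _).symm
    _ ≤ A (m + n) * (A (-n) * A n) := by gcongr; exact one_le n
    _ = A (m + n) * A (-n) * A n := (mul_assoc _ _ _).symm
    _ ≤ A (m + n + -n) * A n := by gcongr; exact hmul _ _
    _ = A m * A n := by rw [add_neg_cancel_right]

end Coaction

section System

variable {R : Type u'} [Ring R]
  {P : Type v'} [AddCommGroup P] [Module R P] [Module Rᵐᵒᵖ P] [SMulCommClass R Rᵐᵒᵖ P]
  {Q : Type w'} [AddCommGroup Q] [Module R Q] [Module Rᵐᵒᵖ Q] [SMulCommClass R Rᵐᵒᵖ Q]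
  (sys : RSystem R P Q)

attribute [local instance] bimodule_symm

/-! ### The canonical subgroups span the Toeplitz ring -/

/-- The image of `ι_R`. -/
abbrev rangeσ : Submodule ℤ (Toeplitz sys) :=
  LinearMap.range ((toeplitzRep sys).σ : R →+ Toeplitz sys).toIntLinearMap

/-- The image of `ι_Q`. -/
abbrev rangeT : Submodule ℤ (Toeplitz sys) := LinearMap.range (toeplitzRep sys).T.toIntLinearMap

/-- The image of `ι_P`. -/
abbrev rangeS : Submodule ℤ (Toeplitz sys) := LinearMap.range (toeplitzRep sys).S.toIntLinearMap

theorem one_mem_rangeσ : (1 : Toeplitz sys) ∈ rangeσ sys := ⟨1, toeplitzRep_one sys⟩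

theorem rangeσ_mul_rangeσ_le : rangeσ sys * rangeσ sys ≤ rangeσ sys := by
  refine Submodule.mul_le.2 ?_
  rintro _ ⟨r, rfl⟩ _ ⟨s, rfl⟩
  exact ⟨r * s, map_mul (toeplitzRep sys).σ r s⟩

theorem rangeσ_mul_rangeT_le : rangeσ sys * rangeT sys ≤ rangeT sys := by
  refine Submodule.mul_le.2 ?_
  rintro _ ⟨r, rfl⟩ _ ⟨q, rfl⟩
  exact ⟨r • q, (toeplitzRep sys).T_left r q⟩

theorem rangeT_mul_rangeσ_le : rangeT sys * rangeσ sys ≤ rangeT sys := by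
  refine Submodule.mul_le.2 ?_
  rintro _ ⟨q, rfl⟩ _ ⟨r, rfl⟩
  exact ⟨MulOpposite.op r • q, (toeplitzRep sys).T_right q r⟩

theorem rangeS_mul_rangeσ_le : rangeS sys * rangeσ sys ≤ rangeS sys := by
  refine Submodule.mul_le.2 ?_
  rintro _ ⟨p, rfl⟩ _ ⟨r, rfl⟩
  exact ⟨MulOpposite.op r • p, (toeplitzRep sys).S_right p r⟩

theorem rangeS_mul_rangeT_le : rangeS sys * rangeT sys ≤ rangeσ sys := by
  refine Submodule.mul_le.2 ?_
  rintro _ ⟨p, rfl⟩ _ ⟨q, rfl⟩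
  exact ⟨sys.psi (btmul R p q), (toeplitzRep sys).σ_psi p q⟩

theorem rangeσ_mul_toeplitzQ_le (m : ℕ) : rangeσ sys * toeplitzQ sys m ≤ toeplitzQ sys m := by
  induction m with
  | zero => exact rangeσ_mul_rangeσ_le sys
  | succ m ih =>
    rw [toeplitzQ, ← mul_assoc]
    gcongr

theorem rangeT_mul_toeplitzQ_le (m : ℕ) :
    rangeT sys * toeplitzQ sys m ≤ toeplitzQ sys (m + 1) := by
  induction m with
  | zero =>
    refine (rangeT_mul_rangeσ_le sys).trans ?_
    calc rangeT sys = 1 * rangeT sys := (one_mul _).symm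
      _ ≤ rangeσ sys * rangeT sys := by gcongr; exact Submodule.one_le.2 (one_mem_rangeσ sys)
  | succ m ih =>
    rw [toeplitzQ, ← mul_assoc, toeplitzQ]
    gcongr

/-- Left multiplication by `ι_P(P)` lowers the number of `Q`-factors by one. -/
theorem rangeS_mul_toeplitzQ_succ_le (m : ℕ) :
    rangeS sys * toeplitzQ sys (m + 1) ≤ toeplitzQ sys m := by
  induction m with
  | zero =>
    calc rangeS sys * (rangeσ sys * rangeT sys) ≤ rangeS sys * rangeT sys := by
          gcongr; exact rangeσ_mul_rangeT_le sys
      _ ≤ rangeσ sys := rangeS_mul_rangeT_le sys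
  | succ m ih =>
    calc rangeS sys * (toeplitzQ sys (m + 1) * rangeT sys)
        = rangeS sys * toeplitzQ sys (m + 1) * rangeT sys := (mul_assoc _ _ _).symm
      _ ≤ toeplitzQ sys m * rangeT sys := by gcongr

theorem toeplitzBi_le_iSup (m n : ℕ) :
    toeplitzBi sys m n ≤ ⨆ i, toeplitzGrading sys i :=
  le_iSup_of_le ((m : ℤ) - n) (le_iSup_of_le m (le_iSup_of_le n (le_iSup_of_le rfl le_rfl)))

theorem mul_iSup_toeplitzGrading_le {X : Submodule ℤ (Toeplitz sys)}
    (h : ∀ m n, X * toeplitzBi sys m n ≤ ⨆ i, toeplitzGrading sys i) :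
    X * ⨆ i, toeplitzGrading sys i ≤ ⨆ i, toeplitzGrading sys i := by
  conv_lhs => simp only [toeplitzGrading, Submodule.mul_iSup]
  exact iSup_le fun i => iSup_le fun m => iSup_le fun n => iSup_le fun _ => h m n

theorem rangeσ_mul_iSup_le :
    rangeσ sys * ⨆ i, toeplitzGrading sys i ≤ ⨆ i, toeplitzGrading sys i := by
  refine mul_iSup_toeplitzGrading_le sys fun m n => le_trans ?_ (toeplitzBi_le_iSup sys m n)
  rw [toeplitzBi, ← mul_assoc]
  gcongr
  exact rangeσ_mul_toeplitzQ_le sys m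

theorem rangeT_mul_iSup_le :
    rangeT sys * ⨆ i, toeplitzGrading sys i ≤ ⨆ i, toeplitzGrading sys i := by
  refine mul_iSup_toeplitzGrading_le sys fun m n =>
    le_trans ?_ (toeplitzBi_le_iSup sys (m + 1) n)
  rw [toeplitzBi, ← mul_assoc]
  exact mul_le_mul' (rangeT_mul_toeplitzQ_le sys m) le_rfl

theorem rangeS_mul_iSup_le :
    rangeS sys * ⨆ i, toeplitzGrading sys i ≤ ⨆ i, toeplitzGrading sys i := by
  refine mul_iSup_toeplitzGrading_le sys fun m n => ?_
  rw [toeplitzBi, ← mul_assoc]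
  cases m with
  | zero =>
    refine le_trans ?_ (toeplitzBi_le_iSup sys 0 (n + 1))
    calc rangeS sys * rangeσ sys * toeplitzP sys n ≤ rangeS sys * toeplitzP sys n := by
          gcongr; exact rangeS_mul_rangeσ_le sys
      _ = 1 * toeplitzP sys (n + 1) := (one_mul _).symm
      _ ≤ rangeσ sys * toeplitzP sys (n + 1) := by
          gcongr; exact Submodule.one_le.2 (one_mem_rangeσ sys)
  | succ m =>
    refine le_trans ?_ (toeplitzBi_le_iSup sys m n)
    rw [toeplitzBi]
    gcongr
    exact rangeS_mul_toeplitzQ_succ_le sys m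

theorem iSup_toeplitzGrading : ⨆ i, toeplitzGrading sys i = ⊤ := by
  set M : Submodule ℤ (Toeplitz sys) := ⨆ i, toeplitzGrading sys i with hM
  have one_mem : (1 : Toeplitz sys) ∈ M := by
    refine toeplitzBi_le_iSup sys 0 0 ?_
    rw [← mul_one (1 : Toeplitz sys)]
    exact Submodule.mul_mem_mul (one_mem_rangeσ sys) (one_mem_rangeσ sys)
  -- the sum of the `T_i` is a left ideal containing `1`
  have mul_mem : ∀ a : FreeAlgebra ℤ (R ⊕ P ⊕ Q), ∀ y ∈ M, toeplitzMk sys a * y ∈ M := by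
    intro a
    induction a using FreeAlgebra.induction with
    | grade0 n =>
      intro y hy
      have h : toeplitzMk sys (algebraMap ℤ _ n) * y = n • y := by simp
      rw [h]
      exact M.smul_mem n hy
    | grade1 g =>
      intro y hy
      rcases g with r | p | q
      · exact rangeσ_mul_iSup_le sys (Submodule.mul_mem_mul ⟨r, rfl⟩ hy)
      · exact rangeS_mul_iSup_le sys (Submodule.mul_mem_mul ⟨p, rfl⟩ hy)
      · exact rangeT_mul_iSup_le sys (Submodule.mul_mem_mul ⟨q, rfl⟩ hy)
    | mul a b ha hb =>
      intro y hy
      rw [map_mul, mul_assoc]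
      exact ha _ (hb y hy)
    | add a b ha hb =>
      intro y hy
      rw [map_add, add_mul]
      exact add_mem (ha y hy) (hb y hy)
  refine (Submodule.eq_top_iff').2 fun z => ?_
  obtain ⟨a, rfl⟩ := RingQuot.mkRingHom_surjective (ToeplitzRel sys) z
  rw [← mul_one (RingQuot.mkRingHom (ToeplitzRel sys) a)]
  exact mul_mem a 1 one_mem

/-! ### The coaction on the relative Cuntz-Pimsner ring -/

variable {sys}

/-- The representation `p ↦ S(p) X⁻¹`, `q ↦ T(q) X`, `r ↦ σ(r)` in `B[X, X⁻¹]`, the Laurent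
polynomial ring being encoded as the monoid ring of `ℤ`. -/
noncomputable def CovariantRep.laurent {B : Type x'} [Ring B] (ρ : CovariantRep sys B) :
    CovariantRep sys (AddMonoidAlgebra B ℤ) where
  S := (AddMonoidAlgebra.singleAddHom (-1)).comp ρ.S
  T := (AddMonoidAlgebra.singleAddHom 1).comp ρ.T
  σ := (AddMonoidAlgebra.singleZeroRingHom : B →+* AddMonoidAlgebra B ℤ).toNonUnitalRingHom.comp ρ.σ
  S_right p r := by
    change AddMonoidAlgebra.single _ _ = AddMonoidAlgebra.single _ _ * AddMonoidAlgebra.single _ _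
    rw [AddMonoidAlgebra.single_mul_single, ρ.S_right]; rfl
  S_left r p := by
    change AddMonoidAlgebra.single _ _ = AddMonoidAlgebra.single _ _ * AddMonoidAlgebra.single _ _
    rw [AddMonoidAlgebra.single_mul_single, ρ.S_left]; rfl
  T_right q r := by
    change AddMonoidAlgebra.single _ _ = AddMonoidAlgebra.single _ _ * AddMonoidAlgebra.single _ _
    rw [AddMonoidAlgebra.single_mul_single, ρ.T_right]; rfl
  T_left r q := by
    change AddMonoidAlgebra.single _ _ = AddMonoidAlgebra.single _ _ * AddMonoidAlgebra.single _ _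
    rw [AddMonoidAlgebra.single_mul_single, ρ.T_left]; rfl
  σ_psi p q := by
    change AddMonoidAlgebra.single _ _ = AddMonoidAlgebra.single _ _ * AddMonoidAlgebra.single _ _
    rw [AddMonoidAlgebra.single_mul_single, ← ρ.σ_psi]; rfl

/-- The composition of the Toeplitz representation with a ring homomorphism. -/
def CovariantRep.ofRingHom {B : Type x'} [Ring B] (f : Toeplitz sys →+* B) :
    CovariantRep sys B where
  S := f.toAddMonoidHom.comp (toeplitzRep sys).S
  T := f.toAddMonoidHom.comp (toeplitzRep sys).T
  σ := f.toNonUnitalRingHom.comp (toeplitzRep sys).σ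
  S_right p r := (congrArg f ((toeplitzRep sys).S_right p r)).trans (map_mul f _ _)
  S_left r p := (congrArg f ((toeplitzRep sys).S_left r p)).trans (map_mul f _ _)
  T_right q r := (congrArg f ((toeplitzRep sys).T_right q r)).trans (map_mul f _ _)
  T_left r q := (congrArg f ((toeplitzRep sys).T_left r q)).trans (map_mul f _ _)
  σ_psi p q := (congrArg f ((toeplitzRep sys).σ_psi p q)).trans (map_mul f _ _)

/-- The elements that `η` sends to `f(x) Xⁱ`, where `f` is a ring homomorphism to `B` and `η` one
to `B[X, X⁻¹]`. -/
noncomputable def homogeneous {A : Type u'} {B : Type x'} [Ring A] [Ring B] (f : A →+* B)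
    (η : A →+* AddMonoidAlgebra B ℤ) (i : ℤ) : Submodule ℤ A :=
  LinearMap.eqLocus η.toAddMonoidHom.toIntLinearMap
    ((AddMonoidAlgebra.singleAddHom i).comp f.toAddMonoidHom).toIntLinearMap

theorem mem_homogeneous {A : Type u'} {B : Type x'} [Ring A] [Ring B] {f : A →+* B}
    {η : A →+* AddMonoidAlgebra B ℤ} {i : ℤ} {x : A} :
    x ∈ homogeneous f η i ↔ η x = AddMonoidAlgebra.single i (f x) := Iff.rfl

theorem homogeneous_mul_le {A : Type u'} {B : Type x'} [Ring A] [Ring B] (f : A →+* B)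
    (η : A →+* AddMonoidAlgebra B ℤ) (i j : ℤ) :
    homogeneous f η i * homogeneous f η j ≤ homogeneous f η (i + j) := by
  refine Submodule.mul_le.2 fun x hx y hy => ?_
  rw [mem_homogeneous] at hx hy ⊢
  rw [map_mul, hx, hy, AddMonoidAlgebra.single_mul_single, map_mul]

/-- Every ring homomorphism `f` from the Toeplitz ring lifts to one with values in Laurent
polynomials, which is `x ↦ f(x) Xⁱ` on the generators of degree `i`. -/
theorem exists_laurentHom {B : Type x'} [Ring B] (f : Toeplitz sys →+* B) :
    ∃ η : Toeplitz sys →+* AddMonoidAlgebra B ℤ, rangeσ sys ≤ homogeneous f η 0 ∧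
      rangeS sys ≤ homogeneous f η (-1) ∧ rangeT sys ≤ homogeneous f η 1 := by
  obtain ⟨η, ⟨hσ, hS, hT⟩, -⟩ := toeplitz_universal sys (CovariantRep.ofRingHom f).laurent
  refine ⟨{ η with map_one' := ?_ }, ?_, ?_, ?_⟩
  · change η 1 = 1
    rw [← toeplitzRep_one, hσ]
    change AddMonoidAlgebra.single 0 (f ((toeplitzRep sys).σ 1)) = 1
    rw [toeplitzRep_one, map_one]
    rfl
  · rintro _ ⟨r, rfl⟩
    exact hσ r
  · rintro _ ⟨p, rfl⟩
    exact hS p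
  · rintro _ ⟨q, rfl⟩
    exact hT q

theorem toeplitzGrading_le_homogeneous {B : Type x'} [Ring B] {f : Toeplitz sys →+* B}
    {η : Toeplitz sys →+* AddMonoidAlgebra B ℤ} (hσ : rangeσ sys ≤ homogeneous f η 0)
    (hS : rangeS sys ≤ homogeneous f η (-1)) (hT : rangeT sys ≤ homogeneous f η 1) (i : ℤ) :
    toeplitzGrading sys i ≤ homogeneous f η i := by
  have hQ : ∀ m : ℕ, toeplitzQ sys m ≤ homogeneous f η m := by
    intro m
    induction m with
    | zero => exact hσ
    | succ m ih =>
      rw [Nat.cast_succ]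
      exact (mul_le_mul' ih hT).trans (homogeneous_mul_le f η m 1)
  have hP : ∀ n : ℕ, toeplitzP sys n ≤ homogeneous f η (-n) := by
    intro n
    induction n with
    | zero => exact hσ
    | succ n ih =>
      have h : (-(n + 1 : ℕ) : ℤ) = -1 + -n := by push_cast; ring
      rw [h]
      exact (mul_le_mul' hS ih).trans (homogeneous_mul_le f η (-1) (-n))
  refine iSup_le fun m => iSup_le fun n => iSup_le fun h => ?_
  rw [← h, sub_eq_add_neg]
  exact (mul_le_mul' (hQ m) (hP n)).trans (homogeneous_mul_le f η m (-n))

theorem pi_mem_rangeT_mul_rangeS (h : sys.ConditionFS) (x : sys.finiteQ) :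
    (toeplitzRep sys).pi h x ∈ rangeT sys * rangeS sys := by
  obtain ⟨t, rfl⟩ := thetaHom'_surjective sys x
  induction t using TensorProduct.induction_on with
  | zero => rw [map_zero, map_zero]; exact zero_mem _
  | tmul q p =>
    have e : (toeplitzRep sys).pi h (thetaHom' sys (q ⊗ₜ[ℤ] p)) = _ :=
      (toeplitzRep sys).pi_theta h q p (thetaHom_mem sys (q ⊗ₜ[ℤ] p))
    rw [e]
    exact Submodule.mul_mem_mul ⟨q, rfl⟩ ⟨p, rfl⟩
  | add a b ha hb => rw [map_add, map_add]; exact add_mem ha hb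

variable (h : sys.ConditionFS) {J : TwoSidedIdeal R} (hJ : sys.IsCompatible J)

theorem exists_cpCoaction : ∃ δ : CPRing sys h J hJ →+* AddMonoidAlgebra (CPRing sys h J hJ) ℤ,
    ∀ i, ∀ x ∈ cpGrading sys h J hJ i, δ x = AddMonoidAlgebra.single i x := by
  set f : Toeplitz sys →+* CPRing sys h J hJ := (cpIdeal sys h J hJ).ringCon.mk' with hf
  obtain ⟨η, hσ, hS, hT⟩ := exists_laurentHom f
  have ideal_le : cpIdeal sys h J hJ ≤ TwoSidedIdeal.ker η := by
    refine TwoSidedIdeal.span_le.2 ?_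
    rintro z ⟨r, hr, rfl⟩
    set z := (toeplitzRep sys).σ r - (toeplitzRep sys).pi h ⟨sys.Delta r, hJ r hr⟩ with hz
    -- a generator of `T(J)` is homogeneous of degree `0`, and its image in the quotient vanishes
    have hz0 : z ∈ homogeneous f η 0 := by
      refine sub_mem (hσ ⟨r, rfl⟩) ?_
      exact ((mul_le_mul' hT hS).trans (homogeneous_mul_le f η 1 (-1)))
        (pi_mem_rangeT_mul_rangeS h _)
    have hfz : f z = 0 := by
      have : z ∈ cpIdeal sys h J hJ := TwoSidedIdeal.subset_span ⟨r, hr, rfl⟩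
      exact (RingCon.eq _).2 this
    refine (TwoSidedIdeal.mem_ker _).2 ?_
    rw [mem_homogeneous.1 hz0, hfz, AddMonoidAlgebra.single_zero]
  refine ⟨(cpIdeal sys h J hJ).ringCon.lift η (TwoSidedIdeal.ringCon_le_iff.1 ideal_le), ?_⟩
  rintro i _ ⟨t, ht, rfl⟩
  exact toeplitzGrading_le_homogeneous hσ hS hT i ht

/-! ### The canonical subgroups of the relative Cuntz-Pimsner ring -/

theorem iSup_cpGrading : ⨆ i, cpGrading sys h J hJ i = ⊤ := by
  simp only [cpGrading]
  rw [← Submodule.map_iSup, iSup_toeplitzGrading, Submodule.map_top, LinearMap.range_eq_top]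
  exact RingCon.mk'_surjective _

theorem rangeT_le_toeplitzGrading : rangeT sys ≤ toeplitzGrading sys 1 := by
  refine le_trans ?_ (le_iSup_of_le 1 (le_iSup_of_le 0 (le_iSup_of_le (by simp) le_rfl)))
  calc rangeT sys = 1 * rangeT sys * 1 := by rw [one_mul, mul_one]
    _ ≤ rangeσ sys * rangeT sys * rangeσ sys := by
        gcongr <;> exact Submodule.one_le.2 (one_mem_rangeσ sys)

theorem rangeS_le_toeplitzGrading : rangeS sys ≤ toeplitzGrading sys (-1) := by
  refine le_trans ?_ (le_iSup_of_le 0 (le_iSup_of_le 1 (le_iSup_of_le (by simp) le_rfl)))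
  calc rangeS sys = 1 * (rangeS sys * 1) := by rw [one_mul, mul_one]
    _ ≤ rangeσ sys * (rangeS sys * rangeσ sys) := by
        gcongr <;> exact Submodule.one_le.2 (one_mem_rangeσ sys)

theorem mk_mem_cpGrading_mul {X Y : Submodule ℤ (Toeplitz sys)} {i j : ℤ}
    (hX : X ≤ toeplitzGrading sys i) (hY : Y ≤ toeplitzGrading sys j) {z : Toeplitz sys}
    (hz : z ∈ X * Y) : (cpIdeal sys h J hJ).ringCon.mk' z ∈
      cpGrading sys h J hJ i * cpGrading sys h J hJ j := by
  induction hz using Submodule.mul_induction_on' with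
  | mem_mul_mem x hx y hy =>
    rw [map_mul]
    exact Submodule.mul_mem_mul ⟨x, hX hx, rfl⟩ ⟨y, hY hy, rfl⟩
  | add x _ y _ hx hy => rw [map_add]; exact add_mem hx hy

/-- If `1 ∈ J`, then `1 = π(Δ(1))` in the relative Cuntz-Pimsner ring. -/
theorem one_mem_cpGrading_one_mul (h_one : (1 : R) ∈ J) :
    (1 : CPRing sys h J hJ) ∈ cpGrading sys h J hJ 1 * cpGrading sys h J hJ (-1) := by
  have hrel : (cpIdeal sys h J hJ).ringCon.mk' 1 = (cpIdeal sys h J hJ).ringCon.mk'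
      ((toeplitzRep sys).pi h ⟨sys.Delta 1, hJ 1 h_one⟩) := by
    refine (RingCon.eq _).2 ((TwoSidedIdeal.rel_iff _ _ _).2 ?_)
    rw [← toeplitzRep_one]
    exact TwoSidedIdeal.subset_span ⟨1, h_one, rfl⟩
  rw [← map_one (cpIdeal sys h J hJ).ringCon.mk', hrel]
  exact mk_mem_cpGrading_mul h hJ rangeT_le_toeplitzGrading rangeS_le_toeplitzGrading
    (pi_mem_rangeT_mul_rangeS h _)

theorem σ_psi_mem_rangeS_mul_rangeT (z : BalancedTensor R P Q) :
    (toeplitzRep sys).σ (sys.psi z) ∈ rangeS sys * rangeT sys := by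
  induction z using btensor_induction with
  | h0 => rw [map_zero, map_zero]; exact zero_mem _
  | hadd a b ha hb => rw [map_add, map_add]; exact add_mem ha hb
  | ht p q =>
    rw [(toeplitzRep sys).σ_psi]
    exact Submodule.mul_mem_mul ⟨p, rfl⟩ ⟨q, rfl⟩

/-- If `ψ` is surjective, then `1 = ι_R(ψ(z))` for some `z ∈ P ⊗_R Q`. -/
theorem one_mem_cpGrading_neg_one_mul (h_surj : Function.Surjective sys.psi) :
    (1 : CPRing sys h J hJ) ∈ cpGrading sys h J hJ (-1) * cpGrading sys h J hJ 1 := by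
  obtain ⟨z, hz⟩ := h_surj 1
  rw [← map_one (cpIdeal sys h J hJ).ringCon.mk', ← toeplitzRep_one, ← hz]
  exact mk_mem_cpGrading_mul h hJ rangeS_le_toeplitzGrading rangeT_le_toeplitzGrading
    (σ_psi_mem_rangeS_mul_rangeT z)

end System

end CuntzPimsner

theorem mainTheorem4 {R : Type*} [Ring R]
    {P : Type*} [AddCommGroup P] [Module R P] [Module Rᵐᵒᵖ P] [SMulCommClass R Rᵐᵒᵖ P]
    {Q : Type*} [AddCommGroup Q] [Module R Q] [Module Rᵐᵒᵖ Q] [SMulCommClass R Rᵐᵒᵖ Q]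
    (sys : CuntzPimsner.RSystem R P Q) (hFS' : sys.ConditionFS')
    (J : TwoSidedIdeal R) (hJ : sys.IsCompatible J)
    (h_one : (1 : R) ∈ J) (h_surj : Function.Surjective sys.psi) :
    CuntzPimsner.IsStrongZGrading
      (CuntzPimsner.cpGrading sys hFS'.conditionFS J hJ) := by
  obtain ⟨δ, hδ⟩ := CuntzPimsner.exists_cpCoaction hFS'.conditionFS hJ
  have htop := CuntzPimsner.iSup_cpGrading hFS'.conditionFS hJ
  exact CuntzPimsner.isStrongZGrading_of_one_mem
    (CuntzPimsner.isInternal_of_coaction δ.toAddMonoidHom hδ htop)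
    (CuntzPimsner.mul_le_of_coaction δ hδ htop)
    (CuntzPimsner.one_mem_cpGrading_one_mul hFS'.conditionFS hJ h_one)
    (CuntzPimsner.one_mem_cpGrading_neg_one_mul hFS'.conditionFS hJ h_surj)
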